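/- Let $T$ be a first-order theory and let $\varphi(x,y)$ be a formula in the language of $T$, where $x$ and $y$ are finite tuples of variables. For a model $M$ of $T$ and a tuple $b\in M^{|y|}$, put $\varphi(M,b)=\{a\in M^{|x|} : M\models\varphi(a,b)\}$; such a set is called an instance of $\varphi$. Automorphisms of $M$ act coordinatewise on tuples. For an automorphism $\sigma$ of $M$ and $U\subseteq M^{|x|}$, let $$\xi_{\sigma,U}\colon M^{|x|}\to 2^{\mathbb Z},\qquad \xi_{\sigma,U}(a)=\{i\in\mathbb Z : \sigma^i(a)\in U\},$$ write $\xi_{\sigma,U}(M)$ for the image of this map, and let $\rho_\varphi(M)=\bigcup_{b\in M^{|y|}}\bigcup_{\sigma\in\mathrm{Aut}(M)}\xi_{\sigma,\varphi(M,b)}(M)$. Subsets of $\mathbb Z$ are identified with binary sequences indexed by $\mathbb Z$, and $2^{\mathbb Z}$ carries the product topology. A finite binary word occurs in $I\in 2^{\mathbb Z}$ if it is a block of consecutive entries of $I$, and $I$ is universal if every finite binary word occurs in it. The formula $\varphi(x,y)$ has the independence property (IP) if there is a model $M$ of $T$ such that for every $n\in\mathbb N$ there are $a_1,\dots,a_n\in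 M^{|x|}$ such that for every $J\subseteq\{1,\dots,n\}$ there is $b_J\in M^{|y|}$ with $M\models\varphi(a_i,b_J)\Leftrightarrow i\in J$ for all $i\in\{1,\dots,n\}$. Theorem. The following are equivalent. 1. The formula $\varphi(x,y)$ has IP. 2. There are a model $M$ of $T$, an instance $U=\varphi(M,b)$ and an automorphism $\sigma$ of $M$ such that $\xi_{\sigma,U}(M)$ is dense in $2^{\mathbb Z}$. 3. There are a model $M$ of $T$ and an automorphism $\sigma$ of $M$ such that for every $n\in\mathbb N$ there is an instance $U_n=\varphi(M,b_n)$ such that every binary word of length $n$ occurs in some element of $\xi_{\sigma,U_n}(M)$. 4. There are a model $M$ of $T$, an instance $U=\varphi(M,b)$ and an automorphism $\sigma$ of $M$ such that $\xi_{\sigma,U}(M)$ contains a universal sequence. 5. There are a model $M$ of $T$, an instance $U=\varphi(M,b)$ and an automorphism $\sigma$ of $M$ such that $\xi_{\sigma,U}(M)=2^{\mathbb Z}$. 6. There is a model $M$ of $T$ such that $\rho_\varphi(M)$ is dense in $2^{\mathbb Z}$. -/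

import Mathlib

open FirstOrder

universe u v w

namespace SymbolicNIP

open FirstOrder.Language

noncomputable section

/-- The space `2^ℤ` of binary `ℤ`-sequences; as a function space with values in the discrete
two-point space `Bool`, it carries the product topology. -/
abbrev BinSeq : Type := ℤ → Bool

/-- The finite binary word `W` occurs in `I` as a block of consecutive entries. -/
def OccursIn {n : ℕ} (W : Fin n → Bool) (I : BinSeq) : Prop :=
  ∃ i : ℤ, ∀ j : Fin n, I (i + ((j : ℕ) : ℤ)) = W j

/-- A binary sequence is universal if every finite binary word occurs in it. -/
def IsUniversal (I : BinSeq) : Prop :=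
  ∀ (n : ℕ) (W : Fin n → Bool), OccursIn W I

open Classical in
/-- The symbolic representation `ξ_{σ,B}(a) = {i ∈ ℤ : σ^i(a) ∈ B}`, as a binary sequence. -/
def symbRep {X : Type*} (σ : Equiv.Perm X) (B : Set X) (a : X) : BinSeq :=
  fun i => decide ((σ ^ i) a ∈ B)

section Structures

variable {L : FirstOrder.Language.{u, v}} {M : Type w} [L.Structure M] {k l : ℕ}

/-- The coordinatewise action of an automorphism of `M` on `k`-tuples of `M`. -/
def tupleAction (k : ℕ) (σ : M ≃[L] M) : Equiv.Perm (Fin k → M) :=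
  (Equiv.refl (Fin k)).arrowCongr σ.toEquiv

/-- The truth of `φ(a, b)` in `M`, for a formula `φ(x, y)` with `|x| = k` and `|y| = l`. -/
def Holds (φ : L.Formula (Fin k ⊕ Fin l)) (a : Fin k → M) (b : Fin l → M) : Prop :=
  φ.Realize (Sum.elim a b)

/-- The instance `φ(M, b)` of `φ(x, y)`. -/
def instanceSet (φ : L.Formula (Fin k ⊕ Fin l)) (b : Fin l → M) : Set (Fin k → M) :=
  {a | Holds φ a b}

/-- The symbolic image `ξ_{σ,U}(M)` of the instance `U = φ(M, b)`. -/
def symbImage (φ : L.Formula (Fin k ⊕ Fin l)) (σ : M ≃[L] M) (b : Fin l → M) : Set BinSeq :=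
  Set.range (symbRep (tupleAction k σ) (instanceSet φ b))

variable (M) in
/-- The total symbolic image `ρ_φ(M)`: the union of the symbolic images of all instances of `φ`
in `M` under all automorphisms of `M`. -/
def totalSymbImage (φ : L.Formula (Fin k ⊕ Fin l)) : Set BinSeq :=
  ⋃ b : Fin l → M, ⋃ σ : M ≃[L] M, symbImage φ σ b

end Structures

/-- `φ(x, y)` has the independence property with respect to `T`: in some model of `T` there are,
for every `n`, tuples `a_1, …, a_n` such that for every set `J` of indices there is a tuple `b_J`
with `φ(a_i, b_J)` if and only if `i ∈ J`. -/
def HasIP {L : FirstOrder.Language.{u, v}} (T : L.Theory) {k l : ℕ}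
    (φ : L.Formula (Fin k ⊕ Fin l)) : Prop :=
  ∃ M : T.ModelType.{u, v, w}, ∀ n : ℕ, ∃ a : Fin n → (Fin k → M),
    ∀ J : Set (Fin n), ∃ b : Fin l → M, ∀ i : Fin n, Holds φ (a i) b ↔ i ∈ J

end

end SymbolicNIP

-- The two substantial steps are 1 → 5 and the recovery of IP from finite words. For the latter, a
-- single word containing all words of length n, read along an orbit of `σ`, is enough. Moving the
-- parameter by a power of `σ` brings each subword onto the same points a, σa, …, σ^(n-1)a, which
-- are therefore shattered (`hasIP_of_forall_word`). For 1 → 5, an ultrapower yields an infinite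
-- sequence all of whose subsets are cut out by instances. A shift-invariant ultrafilter on ℤ → ℕ,
-- playing the role of Ramsey's theorem, turns it into a ℤ-sequence whose shift preserves all
-- formulas of a Skolemized language. The shift then extends to an automorphism of the Skolem hull,
-- an elementary substructure (`exists_shifted_sequence`), and every finite word is cut out along
-- one orbit. A last ultrapower merges parameters b_n exhibiting all words of length 2n into one
-- parameter. A given I is attained by starting, in factor n, in the middle of a window that shows I
-- on [-n, n) (`HasIP.exists_symbImage_eq_univ`).

universe u' v'

namespace SymbolicNIP

open Filter

/-! ### Combinatorics of binary words and shifts -/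

section Words

/-- For every `n` there is a finite word in which every word of length `n` occurs. -/
theorem exists_word_containing_all (n : ℕ) : ∃ (N : ℕ) (W : Fin N → Bool),
    ∀ V : Fin n → Bool, ∃ p : ℕ, ∀ j : Fin n, ∃ h : p + j < N, W ⟨p + j, h⟩ = V j := by
  let e := Fintype.equivFin (Fin n → Bool)
  refine ⟨Fintype.card (Fin n → Bool) * n,
    fun q => e.symm (finProdFinEquiv.symm q).1 (finProdFinEquiv.symm q).2, fun V => ?_⟩
  refine ⟨n * (e V : ℕ), fun j => ?_⟩
  have hval : ((finProdFinEquiv (e V, j) : Fin _) : ℕ) = n * (e V : ℕ) + j := by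
    simp [finProdFinEquiv, add_comm]
  have hlt : n * (e V : ℕ) + j < Fintype.card (Fin n → Bool) * n := by
    rw [← hval]; exact Fin.is_lt _
  refine ⟨hlt, ?_⟩
  have : (⟨n * (e V : ℕ) + j, hlt⟩ : Fin (Fintype.card (Fin n → Bool) * n)) =
      finProdFinEquiv (e V, j) := Fin.ext hval.symm
  rw [this]
  simp only [Equiv.symm_apply_apply]

theorem exists_isUniversal : ∃ I : BinSeq, IsUniversal I := by
  -- Word number m is written from position 2^m on. Pairing its code with its length n forces n ≤ m
  -- < 2^m, so the blocks used do not overlap.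
  let J : ℕ → List Bool := fun m =>
    ((Encodable.decode (Nat.unpair m).1 : Option (List Bool))).getD []
  refine ⟨fun z => (J (Nat.log 2 z.toNat)).getD (z.toNat - 2 ^ Nat.log 2 z.toNat) false,
    fun n W => ?_⟩
  set m := Nat.pair (Encodable.encode (List.ofFn W)) n with hm
  have hJ : J m = List.ofFn W := by simp [J, hm]
  have hn : n < 2 ^ m := lt_of_le_of_lt (Nat.right_le_pair _ _) Nat.lt_two_pow_self
  refine ⟨((2 ^ m : ℕ) : ℤ), fun j => ?_⟩
  have h1 : (((2 ^ m : ℕ) : ℤ) + ((j : ℕ) : ℤ)).toNat = 2 ^ m + j := by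
    rw [← Nat.cast_add, Int.toNat_natCast]
  have h2 : Nat.log 2 (2 ^ m + j) = m := by
    refine (Nat.log_eq_iff (Or.inr ⟨by norm_num, by positivity⟩)).2 ⟨by omega, ?_⟩
    rw [pow_succ]
    have := j.2
    omega
  simp only [h1, h2, hJ]
  simp

theorem exists_mem_occursIn_of_dense {S : Set BinSeq} (hS : Dense S) {n : ℕ} (W : Fin n → Bool) :
    ∃ I ∈ S, OccursIn W I := by
  have hopen : IsOpen {I : BinSeq | ∀ j : Fin n, I ((j : ℕ) : ℤ) = W j} := by
    simp only [Set.ofPred_forall]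
    refine isOpen_iInter_of_finite fun j => ?_
    have hc : Continuous fun I : BinSeq => I ((j : ℕ) : ℤ) := continuous_apply _
    exact (isOpen_discrete ({W j} : Set Bool)).preimage hc
  obtain ⟨I, hI, hIS⟩ := hS.inter_open_nonempty _ hopen
    ⟨fun z => if h : z.toNat < n then W ⟨z.toNat, h⟩ else false, fun j => by simp⟩
  exact ⟨I, hIS, 0, fun j => by simpa using hI j⟩

theorem zpow_apply_of_shift {X : Type*} (τ : Equiv.Perm X) (x : ℤ → X)
    (h : ∀ z, τ (x z) = x (z + 1)) (i z : ℤ) : (τ ^ i) (x z) = x (z + i) := by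
  induction i generalizing z with
  | zero => simp
  | succ i ih =>
    rw [zpow_add, zpow_one, Equiv.Perm.mul_apply, h, ih]
    congr 1; ring
  | pred i ih =>
    rw [zpow_sub, zpow_one, Equiv.Perm.mul_apply]
    have : τ⁻¹ (x z) = x (z - 1) := by
      rw [Equiv.Perm.inv_eq_iff_eq, h]; simp
    rw [this, ih]
    congr 1; ring

end Words

/-! ### A shift-invariant ultrafilter on integer-indexed sequences -/

section IteratedUltrafilter

/-- The `n`-fold iterated product of the hyperfilter on `ℕ`, as an ultrafilter on sequences. -/
noncomputable def iteratedHyperfilter : ℕ → Ultrafilter (ℕ → ℕ)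
  | 0 => pure 0
  | n + 1 => (hyperfilter ℕ).bind fun i =>
      (iteratedHyperfilter n).map fun s q => Nat.casesOn q i s

theorem eventually_iteratedHyperfilter_succ {n : ℕ} {P : (ℕ → ℕ) → Prop} :
    (∀ᶠ s : ℕ → ℕ in iteratedHyperfilter (n + 1), P s) ↔
      ∀ᶠ i in hyperfilter ℕ, ∀ᶠ s : ℕ → ℕ in iteratedHyperfilter n, P fun q => Nat.casesOn q i s :=
  Iff.rfl

theorem eventually_iteratedHyperfilter_tail {n : ℕ} {P : (ℕ → ℕ) → Prop} :
    (∀ᶠ s : ℕ → ℕ in iteratedHyperfilter (n + 1), P fun q => s (q + 1)) ↔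
      ∀ᶠ s : ℕ → ℕ in iteratedHyperfilter n, P s := by
  rw [eventually_iteratedHyperfilter_succ]
  change (∀ᶠ _ : ℕ in (hyperfilter ℕ : Filter ℕ), ∀ᶠ s : ℕ → ℕ in iteratedHyperfilter n, P s) ↔ _
  exact eventually_const

/-- Here the innermost of the n + 1 ultrafilter quantifiers is idle; in
`eventually_iteratedHyperfilter_tail` it is the outermost. -/
theorem eventually_iteratedHyperfilter_init {n : ℕ} {P : (ℕ → ℕ) → Prop}
    (hP : ∀ s t : ℕ → ℕ, (∀ q < n, s q = t q) → (P s ↔ P t)) :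
    (∀ᶠ s : ℕ → ℕ in iteratedHyperfilter (n + 1), P s) ↔ ∀ᶠ s : ℕ → ℕ in iteratedHyperfilter n, P s := by
  induction n generalizing P with
  | zero =>
    have : P = fun _ => P 0 := funext fun s => propext (hP s 0 fun q hq => by omega)
    rw [this, eventually_const, eventually_const]
  | succ n ih =>
    rw [eventually_iteratedHyperfilter_succ, eventually_iteratedHyperfilter_succ]
    refine eventually_congr (Eventually.of_forall fun i => ih fun s t hst => hP _ _ fun q hq => ?_)
    cases q with
    | zero => rfl
    | succ q => exact hst q (by omega)

theorem eventually_iteratedHyperfilter_gt (n i : ℕ) :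
    ∀ᶠ s : ℕ → ℕ in iteratedHyperfilter n, ∀ q < n, i < s q := by
  induction n with
  | zero => exact Eventually.of_forall fun s q hq => by omega
  | succ n ih =>
    rw [eventually_iteratedHyperfilter_succ]
    have : ∀ᶠ j in hyperfilter ℕ, i < j :=
      Nat.hyperfilter_le_atTop (eventually_gt_atTop i)
    filter_upwards [this] with j hj
    filter_upwards [ih] with s hs q hq
    cases q with
    | zero => exact hj
    | succ q => exact hs q (by omega)

theorem eventually_iteratedHyperfilter_lt (n : ℕ) :
    ∀ᶠ s : ℕ → ℕ in iteratedHyperfilter n, ∀ p q, p < q → q < n → s p < s q := by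
  induction n with
  | zero => exact Eventually.of_forall fun s p q _ hq => by omega
  | succ n ih =>
    rw [eventually_iteratedHyperfilter_succ]
    refine Eventually.of_forall fun i => ?_
    filter_upwards [ih, eventually_iteratedHyperfilter_gt n i] with s hs hi p q hpq hq
    cases q with
    | zero => omega
    | succ q =>
      cases p with
      | zero => exact hi q (by omega)
      | succ p => exact hs p q (by omega) (by omega)

/-- There is an ultrafilter on `ℤ → ℕ` that is shift invariant on sets determined by finitely many
coordinates and concentrates on increasing sequences. -/
theorem exists_shift_invariant_ultrafilter : ∃ 𝒱 : Ultrafilter (ℤ → ℕ),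
    (∀ (s : Finset ℤ) (P : (ℤ → ℕ) → Prop),
      (∀ x y : ℤ → ℕ, (∀ z ∈ s, x z = y z) → (P x ↔ P y)) →
      ((∀ᶠ x : ℤ → ℕ in 𝒱, P x) ↔ ∀ᶠ x : ℤ → ℕ in 𝒱, P fun z => x (z + 1))) ∧
    ∀ y z : ℤ, y < z → ∀ᶠ x : ℤ → ℕ in 𝒱, x y < x z := by
  -- A block of 2m coordinates is centred at 0 and m tends to infinity. For a finitely determined
  -- event and large m, the event misses the last coordinate and its shift misses the first, so both
  -- reduce to the (2m - 1)-fold product.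
  let 𝒱 : Ultrafilter (ℤ → ℕ) := (hyperfilter ℕ).bind fun m =>
    (iteratedHyperfilter (2 * m)).map fun s z => s (z + m).toNat
  have h𝒱 : ∀ P : (ℤ → ℕ) → Prop, (∀ᶠ x : ℤ → ℕ in 𝒱, P x) ↔ ∀ᶠ m : ℕ in hyperfilter ℕ,
      ∀ᶠ s : ℕ → ℕ in iteratedHyperfilter (2 * m), P fun z => s (z + m).toNat := fun P => Iff.rfl
  have hlarge : ∀ K : ℕ, ∀ᶠ m : ℕ in hyperfilter ℕ, K ≤ m := fun K =>
    Nat.hyperfilter_le_atTop (eventually_ge_atTop K)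
  refine ⟨𝒱, fun s P hP => ?_, fun y z hyz => ?_⟩
  · rw [h𝒱, h𝒱]
    refine eventually_congr ?_
    filter_upwards [hlarge (s.sup Int.natAbs + 2)] with m hm
    obtain ⟨n, hn⟩ : ∃ n, 2 * m = n + 1 := ⟨2 * m - 1, by omega⟩
    have hs : ∀ z ∈ s, -(m : ℤ) ≤ z ∧ z + m < n := fun z hz => by
      have := Finset.le_sup (f := Int.natAbs) hz
      omega
    rw [hn, eventually_iteratedHyperfilter_init,
      ← eventually_iteratedHyperfilter_tail]
    · refine eventually_congr (Eventually.of_forall fun t => hP _ _ fun z hz => ?_)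
      have := hs z hz
      dsimp only
      congr 1
      omega
    · intro t t' htt'
      refine hP _ _ fun z hz => htt' _ ?_
      have := hs z hz
      omega
  · rw [h𝒱]
    filter_upwards [hlarge (y.natAbs + z.natAbs + 2)] with m hm
    filter_upwards [eventually_iteratedHyperfilter_lt (2 * m)] with s hs
    exact hs _ _ (by omega) (by omega)

end IteratedUltrafilter

open FirstOrder.Language FirstOrder.Language.Structure

/-! ### Dependence on free variables -/

section Realize

variable {L : FirstOrder.Language.{u, v}} {ι : Type*} {M : Type w} [L.Structure M]

theorem realize_congr_of_eqOn_freeVarFinset [DecidableEq ι] (ψ : L.Formula ι) {x y : ι → M}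
    (h : ∀ i ∈ ψ.freeVarFinset, x i = y i) : ψ.Realize x ↔ ψ.Realize y := by
  have hx := BoundedFormula.realize_restrictFreeVar (φ := ψ) (f := id)
    (v := fun i => x i) (v' := x) (xs := default) (fun _ => rfl)
  have hy := BoundedFormula.realize_restrictFreeVar (φ := ψ) (f := id)
    (v := fun i => x i) (v' := y) (xs := default) (fun i => h _ i.2)
  exact hx.symm.trans hy

end Realize

/-! ### Automorphisms of hulls -/

section Hull

variable {L : FirstOrder.Language.{u, v}} {L' : FirstOrder.Language.{u', v'}}
  {ι : Type*} {N : Type w} [L.Structure N] [L'.Structure N]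

theorem mem_closure_range_iff {x : N} (y : ι → N) :
    x ∈ Substructure.closure L' (Set.range y) ↔ ∃ t : L'.Term ι, t.realize y = x := by
  rw [Substructure.mem_closure_iff_exists_term]
  constructor
  · rintro ⟨t, rfl⟩
    refine ⟨t.relabel fun i => i.2.choose, ?_⟩
    rw [Term.realize_relabel]
    congr 1
    funext i
    exact i.2.choose_spec
  · rintro ⟨t, rfl⟩
    refine ⟨t.relabel fun i => ⟨y i, i, rfl⟩, ?_⟩
    rw [Term.realize_relabel]
    rfl

/-- A permutation of the generators that preserves the truth of all `L'`-formulas extends to an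
automorphism of the hull of the generators. -/
theorem exists_equiv_closure_range (j : L →ᴸ L') [j.IsExpansionOn N] (y : ι → N)
    (e : Equiv.Perm ι) (hy : ∀ ψ : L'.Formula ι, ψ.Realize y ↔ ψ.Realize (y ∘ e)) :
    ∃ σ : j.substructureReduct (Substructure.closure L' (Set.range y)) ≃[L]
        j.substructureReduct (Substructure.closure L' (Set.range y)),
      ∀ (i : ι) (x : j.substructureReduct (Substructure.closure L' (Set.range y))),
        (x : N) = y i → (σ x : N) = y (e i) := by
  set S := Substructure.closure L' (Set.range y) with hS
  have hterm : ∀ x : S, ∃ t : L'.Term ι, t.realize y = x := fun x =>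
    (mem_closure_range_iff y).1 x.2
  choose t ht using hterm
  -- Invariance of equations makes t(y) ↦ t(y ∘ e) well defined and injective.
  have heq : ∀ t₁ t₂ : L'.Term ι,
      t₁.realize y = t₂.realize y ↔ t₁.realize (y ∘ e) = t₂.realize (y ∘ e) := fun t₁ t₂ => by
    simpa using hy (t₁.equal t₂)
  have hrange : ∀ t : L'.Term ι, t.realize (y ∘ e) ∈ S := fun t =>
    (mem_closure_range_iff y).2 ⟨t.relabel e, by rw [Term.realize_relabel]⟩
  let f : S → S := fun x => ⟨(t x).realize (y ∘ e), hrange _⟩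
  have hf : ∀ (t₀ : L'.Term ι) (x : S), (x : N) = t₀.realize y →
      (f x : N) = t₀.realize (y ∘ e) := fun t₀ x hx => by
    exact (heq _ _).1 ((ht x).trans hx)
  have hbij : Function.Bijective f := by
    constructor
    · intro x x' hxx'
      have := (heq (t x) (t x')).2 (congrArg Subtype.val hxx')
      rw [ht, ht] at this
      exact Subtype.ext this
    · intro x
      have hmem : ((t x).relabel e.symm).realize y ∈ S := (mem_closure_range_iff y).2 ⟨_, rfl⟩
      refine ⟨⟨_, hmem⟩, Subtype.ext ?_⟩
      rw [hf ((t x).relabel e.symm) ⟨_, hmem⟩ rfl, Term.realize_relabel, ← ht x]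
      congr 1
      funext i
      simp
  refine ⟨⟨Equiv.ofBijective f hbij, ?_, ?_⟩, ?_⟩
  · intro n F x
    have hx : (fun i => (t (x i)).realize y) = fun i => (x i : N) := funext fun i => ht (x i)
    refine Subtype.ext ?_
    have h1 := hf (Term.func (j.onFunction F) fun i => t (x i)) (funMap F x : j.substructureReduct S)
      (by
        simp only [Term.realize, LHom.map_onFunction]
        rw [hx]
        rfl)
    refine h1.trans ?_
    simp only [Term.realize, LHom.map_onFunction]
    rfl
  · intro n R x
    have hx : (fun i => (t (x i)).realize y) = fun i => (x i : N) := funext fun i => ht (x i)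
    have h1 := hy ((j.onRelation R).formula fun i => t (x i))
    simp only [Formula.realize_rel, LHom.map_onRelation] at h1
    rw [hx] at h1
    exact h1.symm
  · intro i x hx
    exact hf (Term.var i) x hx

end Hull

/-! ### Ultrapowers, expansions and induced automorphisms -/

section Ultrapower

variable {L : FirstOrder.Language.{u, v}} {L' : FirstOrder.Language.{u', v'}}
  {Ω : Type*} {M : Type w} [L.Structure M] [L'.Structure M]

theorem exists_ultrapower_rep {𝒱 : Ultrafilter Ω} {n : ℕ}
    (x : Fin n → (𝒱 : Filter Ω).Product fun _ => M) :
    ∃ x' : Fin n → Ω → M, x = fun i => (x' i : (𝒱 : Filter Ω).Product fun _ => M) :=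
  ⟨fun i => (x i).out, funext fun i => ((x i).out_eq').symm⟩

theorem relMap_ultrapower_iff {𝒱 : Ultrafilter Ω} {n : ℕ} (R : L.Relations n)
    (x : Fin n → Ω → M) :
    RelMap R (fun i => (x i : (𝒱 : Filter Ω).Product fun _ => M)) ↔
      ∀ᶠ ω in (𝒱 : Filter Ω), RelMap R fun i => x i ω :=
  let _ := Ultraproduct.setoidPrestructure (L := L) (fun _ : Ω => M) 𝒱
  relMap_quotient_mk' (s := (𝒱 : Filter Ω).productSetoid fun _ => M) R x

instance isExpansionOn_ultrapower (j : L →ᴸ L') [j.IsExpansionOn M] (𝒱 : Ultrafilter Ω) :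
    j.IsExpansionOn ((𝒱 : Filter Ω).Product fun _ => M) where
  map_onFunction {n} F x := by
    obtain ⟨x, rfl⟩ := exists_ultrapower_rep x
    refine (Ultraproduct.funMap_cast _ x).trans
      (Eq.trans ?_ (Ultraproduct.funMap_cast F x).symm)
    simp only [LHom.map_onFunction]
  map_onRelation {n} R x := by
    obtain ⟨x, rfl⟩ := exists_ultrapower_rep x
    refine propext ((relMap_ultrapower_iff _ x).trans
      (Iff.trans ?_ (relMap_ultrapower_iff R x).symm))
    simp only [LHom.map_onRelation]

/-- The automorphism of an ultrapower induced by an automorphism. -/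
def ultrapowerEquiv (𝒱 : Ultrafilter Ω) (σ : M ≃[L] M) :
    ((𝒱 : Filter Ω).Product fun _ => M) ≃[L] ((𝒱 : Filter Ω).Product fun _ => M) where
  toFun := Quotient.map' (fun x ω => σ (x ω)) fun _ _ h =>
    Eventually.mono h fun _ hω => congrArg σ hω
  invFun := Quotient.map' (fun x ω => σ.symm (x ω)) fun _ _ h =>
    Eventually.mono h fun _ hω => congrArg σ.symm hω
  left_inv x := by
    induction x using Quotient.inductionOn' with
    | h x => exact congrArg Quotient.mk'' (funext fun ω => σ.symm_apply_apply (x ω))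
  right_inv x := by
    induction x using Quotient.inductionOn' with
    | h x => exact congrArg Quotient.mk'' (funext fun ω => σ.apply_symm_apply (x ω))
  map_fun' {n} F x := by
    obtain ⟨x, rfl⟩ := exists_ultrapower_rep x
    refine (congrArg _ (Ultraproduct.funMap_cast F x)).trans
      (Eq.trans ?_ (Ultraproduct.funMap_cast F fun i ω => σ (x i ω)).symm)
    exact congrArg Quotient.mk'' (funext fun ω => σ.map_fun F _)
  map_rel' {n} R x := by
    obtain ⟨x, rfl⟩ := exists_ultrapower_rep x
    refine (relMap_ultrapower_iff R fun i ω => σ (x i ω)).trans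
      (Iff.trans ?_ (relMap_ultrapower_iff R x).symm)
    exact eventually_congr (Eventually.of_forall fun ω => σ.map_rel R _)

theorem holds_ultrapower_iff [Nonempty M] {k l : ℕ} (φ : L.Formula (Fin k ⊕ Fin l))
    (𝒱 : Ultrafilter Ω) (a : Fin k → Ω → M) (b : Fin l → Ω → M) :
    Holds φ (fun i => (a i : (𝒱 : Filter Ω).Product fun _ => M))
      (fun i => (b i : (𝒱 : Filter Ω).Product fun _ => M)) ↔
      ∀ᶠ ω in (𝒱 : Filter Ω), Holds φ (fun i => a i ω) fun i => b i ω := by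
  have h := Ultraproduct.realize_formula_cast (u := 𝒱) φ (Sum.elim a b)
  have h1 : (fun i => ((Sum.elim a b i : Ω → M) : (𝒱 : Filter Ω).Product fun _ => M)) =
      Sum.elim (fun i => (a i : (𝒱 : Filter Ω).Product fun _ => M))
        (fun i => (b i : (𝒱 : Filter Ω).Product fun _ => M)) := by
    funext i; cases i <;> rfl
  have h2 : ∀ ω, (fun i => Sum.elim a b i ω) = Sum.elim (fun i => a i ω) fun i => b i ω := by
    intro ω; funext i; cases i <;> rfl
  simp only [h2] at h
  rw [h1] at h
  exact h

theorem model_ultrapower [Nonempty M] (T : L.Theory) [M ⊨ T] (𝒱 : Ultrafilter Ω) :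
    ((𝒱 : Filter Ω).Product fun _ => M) ⊨ T :=
  ⟨fun θ hθ => (Ultraproduct.sentence_realize θ).2
    (Eventually.of_forall fun _ => Theory.realize_sentence_of_mem T hθ)⟩

end Ultrapower

/-! ### Skolem hulls and shifted sequences -/

section Indiscernible

variable {L : FirstOrder.Language.{u, v}} {L' : FirstOrder.Language.{u', v'}}

/-- If `L'` provides Skolem functions for the `L`-formulas in `M`, then every `L'`-substructure
of an ultrapower of `M` is `L`-elementary. -/
theorem isElementary_substructureReduct_ultrapower {Ω : Type*} {M : Type w} [Nonempty M]
    [L.Structure M] [L'.Structure M] (j : L →ᴸ L') [j.IsExpansionOn M]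
    (hsk : ∀ (n : ℕ) (θ : L.BoundedFormula Empty (n + 1)), ∃ F : L'.Functions n,
      ∀ (x : Fin n → M) (m : M), θ.Realize default (Fin.snoc x m : Fin (n + 1) → M) →
        θ.Realize default (Fin.snoc x (funMap F x) : Fin (n + 1) → M))
    (𝒱 : Ultrafilter Ω) (S : L'.Substructure ((𝒱 : Filter Ω).Product fun _ => M)) :
    (j.substructureReduct S).IsElementary := by
  refine Substructure.isElementary_of_exists _ fun n θ x m h => ?_
  obtain ⟨F, hF⟩ := hsk n θ
  obtain ⟨x', hx'⟩ := exists_ultrapower_rep fun i => (x i : (𝒱 : Filter Ω).Product fun _ => M)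
  obtain ⟨m', hm'⟩ := exists_ultrapower_rep fun _ : Fin 1 => m
  have key : ∀ y : Ω → M, (θ.Realize default (Fin.snoc (Subtype.val ∘ x)
      (y : (𝒱 : Filter Ω).Product fun _ => M) :
        Fin (n + 1) → (𝒱 : Filter Ω).Product fun _ => M) ↔
      ∀ᶠ ω in (𝒱 : Filter Ω), θ.Realize default
        (Fin.snoc (fun i => x' i ω) (y ω) : Fin (n + 1) → M)) := by
    intro y
    have h1 := Ultraproduct.boundedFormula_realize_cast (u := 𝒱) θ
      (fun i : Empty => (i.elim : Ω → M)) (Fin.snoc (α := fun _ => Ω → M) x' y)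
    have h2 : (fun i => ((Fin.snoc (α := fun _ => Ω → M) x' y i : Ω → M) :
        (𝒱 : Filter Ω).Product fun _ => M)) =
        Fin.snoc (α := fun _ => (𝒱 : Filter Ω).Product fun _ => M) (Subtype.val ∘ x)
          (y : (𝒱 : Filter Ω).Product fun _ => M) := by
      funext i
      refine Fin.lastCases ?_ (fun i => ?_) i
      · simp only [Fin.snoc_last]
        exact (Fin.snoc_last (α := fun _ => (𝒱 : Filter Ω).Product fun _ => M) _ _).symm
      · simp only [Fin.snoc_castSucc]
        refine (congrFun hx' i).symm.trans ?_
        exact (Fin.snoc_castSucc (α := fun _ => (𝒱 : Filter Ω).Product fun _ => M) _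
          (Subtype.val ∘ x) i).symm
    have h3 : ∀ ω, (fun i => Fin.snoc (α := fun _ => Ω → M) x' y i ω) =
        (Fin.snoc (fun i => x' i ω) (y ω) : Fin (n + 1) → M) := by
      intro ω
      funext i
      refine Fin.lastCases ?_ (fun i => ?_) i
      · simp only [Fin.snoc_last]
      · simp only [Fin.snoc_castSucc]
    rw [h2] at h1
    simp only [h3] at h1
    rw [Subsingleton.elim (default : Empty → (𝒱 : Filter Ω).Product fun _ => M)]
    refine h1.trans (eventually_congr (Eventually.of_forall fun ω => ?_))
    rw [Subsingleton.elim (default : Empty → M)]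
  have hm : m = ((m' 0 : Ω → M) : (𝒱 : Filter Ω).Product fun _ => M) := congrFun hm' 0
  rw [hm, key] at h
  -- Applying the Skolem function in every factor represents its value at `x` in the ultrapower, so
  -- the Tarski–Vaught witness stays in `S`.
  have hmem : (((fun ω => funMap F fun i => x' i ω : Ω → M)) :
      (𝒱 : Filter Ω).Product fun _ => M) ∈ S := by
    have h1 := S.fun_mem F (fun i => (x i : (𝒱 : Filter Ω).Product fun _ => M)) fun i => (x i).2
    rw [hx'] at h1
    have h2 := Ultraproduct.funMap_cast (u := 𝒱) F x'
    exact h2 ▸ h1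
  exact ⟨⟨_, hmem⟩, (key _).2 (h.mono fun ω hω => hF _ _ hω)⟩

/-- From a sequence of tuples in `M` one obtains a `ℤ`-indexed sequence in an elementarily
equivalent structure `N` that is shifted by an automorphism of `N` and satisfies every formula that
holds along all increasing subsequences of the original one. -/
theorem exists_shifted_sequence {M : Type w} [Nonempty M]
    [L.Structure M] [L'.Structure M] (j : L →ᴸ L') [j.IsExpansionOn M]
    (hsk : ∀ (n : ℕ) (θ : L.BoundedFormula Empty (n + 1)), ∃ F : L'.Functions n,
      ∀ (x : Fin n → M) (m : M), θ.Realize default (Fin.snoc x m : Fin (n + 1) → M) →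
        θ.Realize default (Fin.snoc x (funMap F x) : Fin (n + 1) → M))
    (T : L.Theory) [M ⊨ T] {k : ℕ} (a : ℕ → Fin k → M) :
    ∃ (N : T.ModelType.{u, v, w}) (σ : N ≃[L] N) (c : ℤ → Fin k → N),
      (∀ z, tupleAction k σ (c z) = c (z + 1)) ∧
      ∀ (n : ℕ) (ψ : L.Formula (Fin n × Fin k)),
        (∀ s : Fin n → ℕ, StrictMono s → ψ.Realize fun p => a (s p.1) p.2) →
          ψ.Realize fun p => c (p.1 : ℕ) p.2 := by
  obtain ⟨𝒱, hshift, hlt⟩ := exists_shift_invariant_ultrafilter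
  let y : ℤ × Fin k → (ℤ → ℕ) → M := fun p x => a (x p.1) p.2
  let y' : ℤ × Fin k → (𝒱 : Filter (ℤ → ℕ)).Product fun _ => M := fun p => (y p : _)
  let e : Equiv.Perm (ℤ × Fin k) := (Equiv.addRight (1 : ℤ)).prodCongr (Equiv.refl _)
  have hy : ∀ ψ : L'.Formula (ℤ × Fin k), ψ.Realize y' ↔ ψ.Realize (y' ∘ e) := by
    intro ψ
    refine (Ultraproduct.realize_formula_cast ψ y).trans
      (Iff.trans ?_ (Ultraproduct.realize_formula_cast ψ (y ∘ e)).symm)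
    -- By Łoś the claim concerns an event depending only on the finitely many indices occurring in
    -- `ψ`.
    refine hshift (ψ.freeVarFinset.image Prod.fst) (fun x => ψ.Realize fun p => y p x) ?_
    intro x x' hxx'
    refine realize_congr_of_eqOn_freeVarFinset ψ fun p hp => ?_
    simp only [y, hxx' p.1 (Finset.mem_image_of_mem _ hp)]
  let S := Substructure.closure L' (Set.range y')
  obtain ⟨σ, hσ⟩ := exists_equiv_closure_range j y' e hy
  let E : L.ElementarySubstructure ((𝒱 : Filter (ℤ → ℕ)).Product fun _ => M) :=
    ⟨j.substructureReduct S, isElementary_substructureReduct_ultrapower j hsk 𝒱 S⟩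
  have hE : E ⊨ T := (E.theory_model_iff T).2 (model_ultrapower T 𝒱)
  have hne : Nonempty E := by
    -- Any nullary Skolem function will do; it is needed when k = 0 leaves no generators.
    obtain ⟨F, -⟩ := hsk 0 ⊥
    exact ⟨⟨_, S.fun_mem F (fun i => i.elim0) fun i => i.elim0⟩⟩
  have hc : ∀ p, y' p ∈ S := fun p => Substructure.subset_closure ⟨p, rfl⟩
  refine ⟨Theory.ModelType.of T E, σ, fun z i => ⟨y' (z, i), hc _⟩, fun z => ?_, fun n ψ hψ => ?_⟩
  · funext i
    exact Subtype.ext (hσ (z, i) ⟨y' (z, i), hc _⟩ rfl)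
  · refine (E.subtype.map_formula ψ _).1 ?_
    refine (Ultraproduct.realize_formula_cast ψ
      fun p : Fin n × Fin k => y (((p.1 : ℕ) : ℤ), p.2)).2 ?_
    have : ∀ᶠ x : ℤ → ℕ in (𝒱 : Filter (ℤ → ℕ)), ∀ p q : Fin n, p < q →
        x ((p : ℕ) : ℤ) < x ((q : ℕ) : ℤ) := by
      refine eventually_all.2 fun p => eventually_all.2 fun q => ?_
      by_cases hpq : p < q
      · exact (hlt _ _ (by exact_mod_cast hpq)).mono fun x hx _ => hx
      · exact Eventually.of_forall fun x h => absurd h hpq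
    filter_upwards [this] with x hx
    exact hψ (fun p => x ((p : ℕ) : ℤ)) fun p q => hx p q

end Indiscernible

/-! ### From finite words to IP -/

section Automorphisms

variable {L : FirstOrder.Language.{u, v}} {M : Type w} [L.Structure M] {k l : ℕ}

theorem holds_tupleAction_iff (φ : L.Formula (Fin k ⊕ Fin l)) (σ : M ≃[L] M)
    (a : Fin k → M) (b : Fin l → M) :
    Holds φ (tupleAction k σ a) (tupleAction l σ b) ↔ Holds φ a b := by
  have h : Sum.elim (tupleAction k σ a) (tupleAction l σ b) = σ ∘ Sum.elim a b := by
    funext i; cases i <;> rfl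
  unfold Holds
  rw [h]
  exact StrongHomClass.realize_formula σ φ

theorem holds_tupleAction_zpow_iff (φ : L.Formula (Fin k ⊕ Fin l)) (σ : M ≃[L] M) (i : ℤ)
    (a : Fin k → M) (b : Fin l → M) :
    Holds φ ((tupleAction k σ ^ i) a) ((tupleAction l σ ^ i) b) ↔ Holds φ a b := by
  induction i generalizing a b with
  | zero => rfl
  | succ i ih =>
    rw [zpow_add, zpow_add, zpow_one, zpow_one, Equiv.Perm.mul_apply, Equiv.Perm.mul_apply, ih,
      holds_tupleAction_iff]
  | pred i ih =>
    rw [zpow_sub, zpow_sub, zpow_one, zpow_one, Equiv.Perm.mul_apply, Equiv.Perm.mul_apply, ih,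
      ← holds_tupleAction_iff φ σ]
    simp only [← Equiv.Perm.mul_apply, mul_inv_cancel, Equiv.Perm.one_apply]

theorem symbRep_eq_iff {X : Type*} (τ : Equiv.Perm X) (B : Set X) (a : X) (i : ℤ) (t : Bool) :
    symbRep τ B a i = t ↔ ((τ ^ i) a ∈ B ↔ t = true) := by
  cases t <;> simp [symbRep]

/-- If all finite words occur in the symbolic representations coming from one model, then `φ` has
the independence property. -/
theorem hasIP_of_forall_word {T : L.Theory} {φ : L.Formula (Fin k ⊕ Fin l)}
    (M : T.ModelType.{u, v, w})
    (h : ∀ (n : ℕ) (W : Fin n → Bool), ∃ (σ : M ≃[L] M) (b : Fin l → M),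
      ∃ I ∈ symbImage φ σ b, OccursIn W I) : HasIP.{u, v, w} T φ := by
  classical
  refine ⟨M, fun n => ?_⟩
  obtain ⟨N, W, hW⟩ := exists_word_containing_all n
  obtain ⟨σ, b, -, ⟨a, rfl⟩, i₀, hi₀⟩ := h N W
  refine ⟨fun i => (tupleAction k σ ^ ((i : ℕ) : ℤ)) a, fun J => ?_⟩
  obtain ⟨p, hp⟩ := hW fun i => decide (i ∈ J)
  -- The subword for `J` starts at orbit position i₀ + p; pulling the parameter back moves it to
  -- position 0, so the points do not depend on `J`.
  refine ⟨(tupleAction l σ ^ (-(i₀ + p))) b, fun i => ?_⟩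
  obtain ⟨hlt, hval⟩ := hp i
  have h1 := (symbRep_eq_iff _ _ _ _ _).1 ((hi₀ ⟨p + i, hlt⟩).trans hval)
  rw [decide_eq_true_iff] at h1
  rw [← h1, ← holds_tupleAction_zpow_iff φ σ (i₀ + p)]
  rw [← Equiv.Perm.mul_apply, ← Equiv.Perm.mul_apply, ← zpow_add, ← zpow_add, add_neg_cancel,
    zpow_zero, Equiv.Perm.one_apply]
  have : i₀ + ((p + (i : ℕ) : ℕ) : ℤ) = i₀ + p + (i : ℕ) := by push_cast; ring
  change _ ↔ Holds φ ((tupleAction k σ ^ (i₀ + ((p + (i : ℕ) : ℕ) : ℤ))) a) b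
  rw [this]

end Automorphisms

/-! ### From IP to the full symbolic image -/

section Construction

variable {L : FirstOrder.Language.{u, v}} {T : L.Theory} {k l : ℕ}
  {φ : L.Formula (Fin k ⊕ Fin l)}

/-- A formula with IP has, in some model, an infinite sequence all of whose subsets are cut out
by instances. -/
theorem HasIP.exists_infinite_sequence (h : HasIP.{u, v, w} T φ) :
    ∃ (M : T.ModelType.{u, v, w}) (a : ℕ → Fin k → M),
      ∀ g : ℕ → Bool, ∃ b : Fin l → M, ∀ i, Holds φ (a i) b ↔ g i = true := by
  obtain ⟨M, hM⟩ := h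
  choose a hb using hM
  let d : M := Classical.arbitrary M
  have := model_ultrapower (M := M) T (hyperfilter ℕ)
  refine ⟨Theory.ModelType.of T ((hyperfilter ℕ : Filter ℕ).Product fun _ => (M : Type w)),
    fun i j => ((fun n => if h : i < n then a n ⟨i, h⟩ j else d : ℕ → M) :
      (hyperfilter ℕ : Filter ℕ).Product fun _ => (M : Type _)), fun g => ?_⟩
  choose b hb using fun n => hb n {i | g i = true}
  refine ⟨fun j => ((fun n => b n j : ℕ → M) :
    (hyperfilter ℕ : Filter ℕ).Product fun _ => (M : Type _)), fun i => ?_⟩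
  refine (holds_ultrapower_iff φ (hyperfilter ℕ) (fun j n => if h : i < n then a n ⟨i, h⟩ j else d)
    fun j n => b n j).trans ?_
  have hlarge : ∀ᶠ n in (hyperfilter ℕ : Filter ℕ), i < n :=
    Nat.hyperfilter_le_atTop (eventually_gt_atTop i)
  rw [← eventually_const (f := (hyperfilter ℕ : Filter ℕ)) (p := g i = true)]
  refine eventually_congr (hlarge.mono fun n hn => ?_)
  simp only [hn, dif_pos]
  exact hb n ⟨i, hn⟩

/-- The formula expressing that some instance of `φ` cuts out the word `W` from a given
sequence. -/
noncomputable def wordFormula (φ : L.Formula (Fin k ⊕ Fin l)) {n : ℕ} (W : Fin n → Bool) :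
    L.Formula (Fin n × Fin k) :=
  Formula.iExs (Fin l) (Formula.iInf fun i : Fin n =>
    let ψ : L.Formula ((Fin n × Fin k) ⊕ Fin l) := φ.relabel (Sum.map (fun j => (i, j)) id)
    if W i then ψ else ψ.not)

theorem realize_wordFormula {M : Type w} [L.Structure M] {n : ℕ} (W : Fin n → Bool)
    (a : Fin n → Fin k → M) : (wordFormula φ W).Realize (fun p => a p.1 p.2) ↔
      ∃ b : Fin l → M, ∀ i, Holds φ (a i) b ↔ W i = true := by
  rw [wordFormula, Formula.realize_iExs]
  refine exists_congr fun b => ?_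
  rw [Formula.realize_iInf]
  refine forall_congr' fun i => ?_
  have h : Sum.elim (fun p : Fin n × Fin k => a p.1 p.2) b ∘ Sum.map (fun j => (i, j)) id =
      Sum.elim (a i) b := by
    funext j; cases j <;> rfl
  cases hW : W i <;> simp [Formula.realize_relabel, h, Holds]

theorem HasIP.exists_shift (h : HasIP.{u, v, max u v w} T φ) :
    ∃ (N : T.ModelType.{u, v, max u v w}) (σ : N ≃[L] N) (a : Fin k → N),
      ∀ (n : ℕ) (W : Fin n → Bool), ∃ b : Fin l → N,
        ∀ i : Fin n, Holds φ ((tupleAction k σ ^ ((i : ℕ) : ℤ)) a) b ↔ W i = true := by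
  obtain ⟨M, a, ha⟩ := h.exists_infinite_sequence
  -- One round of Skolemization suffices, since the hull need only be elementary for `L`.
  obtain ⟨N, σ, c, hσ, hc⟩ := exists_shifted_sequence (L' := L.sum L.skolem₁) LHom.sumInl
    (fun n θ => ⟨LHom.sumInr.onFunction θ, fun x m hm => by
      exact Classical.epsilon_spec (p := fun m => θ.Realize default (Fin.snoc x m)) ⟨m, hm⟩⟩) T a
  refine ⟨N, σ, c 0, fun n W => ?_⟩
  have h1 := (realize_wordFormula W fun i : Fin n => c (i : ℕ)).1 <| hc n (wordFormula φ W)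
    fun s hs => (realize_wordFormula W fun i => a (s i)).2 <| by
      -- Only the pattern on the range of `s` matters; `false` elsewhere is arbitrary.
      obtain ⟨b, hb⟩ := ha (Function.extend s W fun _ => false)
      exact ⟨b, fun i => by rw [hb, hs.injective.extend_apply]⟩
  obtain ⟨b, hb⟩ := h1
  refine ⟨b, fun i => ?_⟩
  rw [zpow_apply_of_shift _ c hσ, zero_add]
  exact hb i

theorem HasIP.exists_symbImage_eq_univ (h : HasIP.{u, v, max u v w} T φ) :
    ∃ (M : T.ModelType.{u, v, max u v w}) (b : Fin l → M) (σ : M ≃[L] M),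
      symbImage φ σ b = Set.univ := by
  obtain ⟨N, σ, a, ha⟩ := HasIP.exists_shift.{u, v, w} h
  have hblock : ∀ n : ℕ, ∃ b : Fin l → N, ∀ V : Fin n → Bool, ∃ p : ℕ, ∀ i : Fin n,
      Holds φ ((tupleAction k σ ^ ((p + i : ℕ) : ℤ)) a) b ↔ V i = true := by
    intro n
    obtain ⟨K, W, hW⟩ := exists_word_containing_all n
    obtain ⟨b, hb⟩ := ha K W
    refine ⟨b, fun V => ?_⟩
    obtain ⟨p, hp⟩ := hW V
    refine ⟨p, fun i => ?_⟩
    obtain ⟨hlt, hval⟩ := hp i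
    rw [← hval]
    exact hb ⟨p + i, hlt⟩
  choose b hb using fun n => hblock (2 * n)
  have := model_ultrapower (M := N) T (hyperfilter ℕ)
  let b' : Fin l → (hyperfilter ℕ : Filter ℕ).Product fun _ => (N : Type _) :=
    fun j => ((fun n => b n j : ℕ → N) : _)
  refine ⟨Theory.ModelType.of T ((hyperfilter ℕ : Filter ℕ).Product fun _ => (N : Type _)),
    b', ultrapowerEquiv (hyperfilter ℕ) σ,
    Set.eq_univ_of_forall fun I => ?_⟩
  choose p hp using fun n => hb n fun i => I ((i : ℕ) - n)
  -- The window for I on [-n, n) starts at orbit position p n, so entry 0 of I sits at p n + n. Only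
  -- this starting point depends on I; the parameter `b'` does not.
  let c : ℤ → Fin k → ℕ → N := fun z j n => (tupleAction k σ ^ ((p n : ℤ) + n + z)) a j
  let c' : ℤ → Fin k → (hyperfilter ℕ : Filter ℕ).Product fun _ => (N : Type _) :=
    fun z j => (c z j : _)
  have hc : ∀ z, tupleAction k (ultrapowerEquiv (hyperfilter ℕ) σ) (c' z) = c' (z + 1) := by
    intro z
    funext j
    refine congrArg Quotient.mk'' (funext fun n => ?_)
    change tupleAction k σ ((tupleAction k σ ^ ((p n : ℤ) + n + z)) a) j = _
    rw [← Equiv.Perm.mul_apply, ← zpow_one_add]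
    have : 1 + ((p n : ℤ) + n + z) = (p n : ℤ) + n + (z + 1) := by ring
    rw [this]
  refine ⟨c' 0, funext fun i => (symbRep_eq_iff _ _ _ _ _).2 ?_⟩
  have hz := zpow_apply_of_shift _ c' hc i 0
  rw [zero_add] at hz
  refine (iff_of_eq (congrArg (fun q => Holds φ q b') hz)).trans ?_
  refine (holds_ultrapower_iff φ (hyperfilter ℕ) (c i) fun j n => b n j).trans ?_
  have hlarge : ∀ᶠ n in (hyperfilter ℕ : Filter ℕ), i.natAbs < n :=
    Nat.hyperfilter_le_atTop (eventually_gt_atTop _)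
  rw [← eventually_const (f := (hyperfilter ℕ : Filter ℕ)) (p := I i = true)]
  refine eventually_congr (hlarge.mono fun n hn => ?_)
  have h1 := hp n ⟨(i + n).toNat, by omega⟩
  have h2 : ((p n + (i + n).toNat : ℕ) : ℤ) = (p n : ℤ) + n + i := by omega
  have h3 : (((i + n).toNat : ℕ) : ℤ) - n = i := by omega
  simp only [h2, h3] at h1
  exact h1

end Construction

end SymbolicNIP

/-! ### The equivalences -/

theorem mainTheorem3 {L : FirstOrder.Language.{u, v}} (T : L.Theory) {k l : ℕ}
    (φ : L.Formula (Fin k ⊕ Fin l)) :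
    List.TFAE [
      SymbolicNIP.HasIP.{u, v, max u v w} T φ,
      ∃ (M : FirstOrder.Language.Theory.ModelType.{u, v, max u v w} T)
        (b : Fin l → M) (σ : M ≃[L] M),
        Dense (SymbolicNIP.symbImage φ σ b),
      ∃ (M : FirstOrder.Language.Theory.ModelType.{u, v, max u v w} T) (σ : M ≃[L] M),
        ∀ n : ℕ, ∃ b : Fin l → M, ∀ W : Fin n → Bool,
          ∃ I ∈ SymbolicNIP.symbImage φ σ b, SymbolicNIP.OccursIn W I,
      ∃ (M : FirstOrder.Language.Theory.ModelType.{u, v, max u v w} T)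
        (b : Fin l → M) (σ : M ≃[L] M),
        ∃ I ∈ SymbolicNIP.symbImage φ σ b, SymbolicNIP.IsUniversal I,
      ∃ (M : FirstOrder.Language.Theory.ModelType.{u, v, max u v w} T)
        (b : Fin l → M) (σ : M ≃[L] M),
        SymbolicNIP.symbImage φ σ b = Set.univ,
      ∃ M : FirstOrder.Language.Theory.ModelType.{u, v, max u v w} T,
        Dense (SymbolicNIP.totalSymbImage M φ)] := by
  tfae_have 1 → 5 := SymbolicNIP.HasIP.exists_symbImage_eq_univ.{u, v, w}
  tfae_have 5 → 2 := fun ⟨M, b, σ, h⟩ => ⟨M, b, σ, h ▸ dense_univ⟩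
  tfae_have 5 → 4 := fun ⟨M, b, σ, h⟩ =>
    let ⟨I, hI⟩ := SymbolicNIP.exists_isUniversal
    ⟨M, b, σ, I, h ▸ Set.mem_univ I, hI⟩
  tfae_have 2 → 3 := fun ⟨M, b, σ, h⟩ =>
    ⟨M, σ, fun _ => ⟨b, fun W => SymbolicNIP.exists_mem_occursIn_of_dense h W⟩⟩
  tfae_have 2 → 6 := fun ⟨M, b, σ, h⟩ =>
    ⟨M, h.mono (Set.subset_iUnion_of_subset b (Set.subset_iUnion_of_subset σ subset_rfl))⟩
  tfae_have 3 → 1 := fun ⟨M, σ, h⟩ => SymbolicNIP.hasIP_of_forall_word M fun n W =>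
    let ⟨b, hb⟩ := h n
    ⟨σ, b, hb W⟩
  tfae_have 4 → 1 := fun ⟨M, b, σ, I, hI, hU⟩ => SymbolicNIP.hasIP_of_forall_word M fun n W =>
    ⟨σ, b, I, hI, hU n W⟩
  tfae_have 6 → 1 := fun ⟨M, h⟩ => SymbolicNIP.hasIP_of_forall_word M fun n W => by
    obtain ⟨I, hI, hW⟩ := SymbolicNIP.exists_mem_occursIn_of_dense h W
    obtain ⟨b, hI⟩ := Set.mem_iUnion.1 hI
    obtain ⟨σ, hI⟩ := Set.mem_iUnion.1 hI
    exact ⟨σ, b, I, hI, hW⟩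
  tfae_finish
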